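/- **Theorem.** Let $\Gamma$ be a compact Hausdorff topological group with normalized (Radon) Haar measure $\mu$, and let $V$ be a homogeneous $\Gamma$-space, that is, a Hausdorff space with a continuous transitive action of $\Gamma$ such that the orbit maps $\sigma\mapsto\sigma e$, $e\in V$, are open. Equip $V$ with the pushforward $\omega$ of $\mu$ under $\sigma\mapsto \sigma e$ for some $e\in V$, and powers of $V$ with the product measures. Let $L^2_{\mathrm{sym}}(V)$ be the space of real kernels $K\in L^2(V^2)$ with $K(x,y)=K(y,x)$ almost everywhere, and for $K\in L^2(V^2)$ and $f\in L^2(V)$ let $(Kf)(x)=\int_V K(x,y)f(y)\,d\omega(y)$. Let $$\mathrm{COP}(V)=\{Z\in L^2_{\mathrm{sym}}(V):\langle Zf,f\rangle\ge 0\text{ for all } f\in L^2(V)\text{ with } f\ge 0\text{ a.e.}\}$$ and let $$\mathrm{CP}(V)=\{A\in L^2_{\mathrm{sym}}(V):\langle A,Z\rangle\ge 0\text{ for all }Z\in\mathrm{COP}(V)\}$$ be the cone of completely positive kernels. For each integer $r\ge 1$ let $$\mathcal K_r(V)=\Bigl\{Z\in L^2_{\mathrm{sym}}(V): \frac1{(r+2)!}\sum_{\pi\in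 S_{r+2}} Z(x_{\pi(1)},x_{\pi(2)})\ge 0\text{ for almost every }(x_1,\dots,x_{r+2})\in V^{r+2}\Bigr\}.$$ If $A\in L^2_{\mathrm{sym}}(V)$ satisfies $\langle A,Z\rangle\ge 0$ for all $Z\in\bigcup_{r\ge1}\mathcal K_r(V)$, then $A$ is completely positive. -/

import Mathlib

open MeasureTheory
open scoped ENNReal

noncomputable section

/-- `V` is a homogeneous `Γ`-space: the (continuous) action is transitive and the orbit maps
`σ ↦ σ • e` from `Γ` to `V` are open. -/
structure IsHomogeneousSpace (Γ V : Type*) [Group Γ] [TopologicalSpace Γ] [TopologicalSpace V]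
    [MulAction Γ V] : Prop where
  continuous_action : Continuous fun p : Γ × V => p.1 • p.2
  transitive : ∀ x y : V, ∃ σ : Γ, σ • x = y
  isOpenMap_orbit : ∀ e : V, IsOpenMap fun σ : Γ => σ • e

/-- The pushforward to `V` of a measure on `Γ` through the orbit map `σ ↦ σ • e`. -/
abbrev haarPushforward {Γ V : Type*} [Group Γ] [MeasurableSpace Γ] [MeasurableSpace V]
    [MulAction Γ V] (μ : Measure Γ) (e : V) : Measure V :=
  Measure.map (fun σ : Γ => σ • e) μ

section Kernels

variable {V : Type*} [MeasurableSpace V]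

/-- The space `L²(V²)` of (real) kernels, for the product measure. -/
abbrev L2Kernel (ω : Measure V) : Type _ := Lp ℝ 2 (ω.prod ω)

/-- The space `L²_sym(V)` of symmetric kernels: `K(x, y) = K(y, x)` almost everywhere. -/
def symmKernels (ω : Measure V) [SFinite ω] : Submodule ℝ (L2Kernel ω) where
  carrier := {K | ∀ᵐ p ∂(ω.prod ω), K (p.1, p.2) = K (p.2, p.1)}
  zero_mem' := by
    have h := Lp.coeFn_zero ℝ 2 (ω.prod ω)
    filter_upwards [h, (Measure.measurePreserving_swap (μ := ω) (ν := ω)).quasiMeasurePreserving.ae h]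
      with p h1 h2
    exact h1.trans h2.symm
  add_mem' := by
    intro K L hK hL
    have h := Lp.coeFn_add K L
    filter_upwards [hK, hL, h,
      (Measure.measurePreserving_swap (μ := ω) (ν := ω)).quasiMeasurePreserving.ae h]
      with p hK hL h1 h2
    refine h1.trans (Eq.trans ?_ h2.symm)
    exact congrArg₂ (· + ·) hK hL
  smul_mem' := by
    intro c K hK
    have h := Lp.coeFn_smul c K
    filter_upwards [hK, h,
      (Measure.measurePreserving_swap (μ := ω) (ν := ω)).quasiMeasurePreserving.ae h]
      with p hK h1 h2
    refine h1.trans (Eq.trans ?_ h2.symm)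
    exact congrArg (c • ·) hK

/-- The integral operator of a kernel: `(K f)(x) = ∫ K(x, y) f(y) dω(y)`. -/
def kernelOp (ω : Measure V) (K : L2Kernel ω) (f : Lp ℝ 2 ω) : V → ℝ :=
  fun x => ∫ y, K (x, y) * f y ∂ω

/-- The copositive cone: symmetric kernels `A` with `⟨A f, f⟩ ≥ 0` for every `f ∈ L²(V)` that is
nonnegative almost everywhere. -/
def copCone (ω : Measure V) [SFinite ω] : Set (L2Kernel ω) :=
  {A | A ∈ symmKernels ω ∧
    ∀ f : Lp ℝ 2 ω, (∀ᵐ x ∂ω, 0 ≤ f x) → 0 ≤ ∫ x, kernelOp ω A f x * f x ∂ω}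

/-- The completely positive cone, the dual of the copositive cone in the space of symmetric
kernels, for the `L²` inner product. -/
def cpCone (ω : Measure V) [SFinite ω] : Set (L2Kernel ω) :=
  {A | A ∈ symmKernels ω ∧ ∀ Z ∈ copCone ω, 0 ≤ inner ℝ A Z}

/-- The function `A ⊗ 1 ⊗ ⋯ ⊗ 1` on `V ^ (r + 2)`, with `r` constant-one factors. -/
def tensorOnes (r : ℕ) (A : V × V → ℝ) : (Fin (r + 2) → V) → ℝ :=
  fun x => A (x 0, x 1) * ∏ _i : Fin r, (1 : ℝ)

/-- The Reynolds operator of the symmetric group acting on `V ^ k` by permuting coordinates. -/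
def symmReynolds (k : ℕ) (F : (Fin k → V) → ℝ) : (Fin k → V) → ℝ :=
  fun x => (1 / (k.factorial : ℝ)) * ∑ π : Equiv.Perm (Fin k), F (fun i => x (π i))

/-- The cone `K_r(V)`: symmetric kernels `A` such that the symmetrization of `A ⊗ 1^{⊗ r}` is
nonnegative almost everywhere on `V ^ (r + 2)` for the product measure. -/
def kpCone (ω : Measure V) [SFinite ω] (r : ℕ) : Set (L2Kernel ω) :=
  {A | A ∈ symmKernels ω ∧
    ∀ᵐ x ∂(Measure.pi fun _ : Fin (r + 2) => ω), 0 ≤ symmReynolds (r + 2) (tensorOnes r A) x}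

end Kernels

end

/-! ### Averaging over a finite partition as an orthogonal projection. -/

section StepFunctions

variable {X κ : Type*} [MeasurableSpace X] [Fintype κ] [MeasurableSpace κ]
  [MeasurableSingletonClass κ]

variable {P : Measure X} {q : X → κ}

/-! Let `Z` be copositive, and let `c` be its averages over the product cells of a finite partition
`q` of `V`. Testing `Z` against normalized indicators of cells shows that `∑ a, ∑ b, c (q (x a), q
(x b)) ≥ 0` for all finite families of points (`sum_sum_fibreAverage_nonneg`). The symmetrization
defining `K_r` is a positive multiple of the sum over pairs of distinct indices. Dropping the
diagonal loses `O(r)`, while adding a constant `ε > 0` gains order `ε r²`, so the averaged kernel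
plus `ε` lies in `K_r` for large `r` (`add_const_mem_kpCone`).

Letting `ε → 0` gives `⟨A, ·⟩ ≥ 0` on the averaged kernels. These approximate `Z` in `L²`
(`exists_stepLp_norm_sub_lt`), whence `⟨A, Z⟩ ≥ 0`. -/

theorem integral_mul_comp_finite (hq : Measurable q) (c : κ → ℝ) {K : X → ℝ}
    (hK : Integrable K P) :
    ∫ x, K x * c (q x) ∂P = ∑ k, c k * ∫ x in q ⁻¹' {k}, K x ∂P := by
  classical
  have h : ∀ x, K x * c (q x) = ∑ k, c k * (q ⁻¹' {k}).indicator K x := by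
    intro x
    rw [Finset.sum_eq_single (q x)]
    · simp [mul_comm]
    · intro b _ hb
      rw [Set.indicator_of_notMem (by simpa using hb.symm), mul_zero]
    · simp
  have hm : ∀ k, MeasurableSet (q ⁻¹' {k}) := fun k => hq (measurableSet_singleton k)
  simp_rw [h]
  rw [integral_finsetSum _ fun k _ => (hK.indicator (hm k)).const_mul (c k)]
  refine Finset.sum_congr rfl fun k _ => ?_
  rw [integral_const_mul, integral_indicator (hm k)]

theorem memLp_comp_finite (P : Measure X) [IsFiniteMeasure P] (hq : Measurable q)
    (c : κ → ℝ) (p : ℝ≥0∞) : MemLp (fun x => c (q x)) p P := by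
  refine MemLp.of_bound (C := ∑ k, |c k|)
    ((measurable_of_finite c).comp hq).aestronglyMeasurable (ae_of_all _ fun x => ?_)
  exact Finset.single_le_sum (f := fun k => |c k|) (fun _ _ => abs_nonneg _) (Finset.mem_univ (q x))

/-- The class in `L²` of the function `c ∘ q`, for a map `q` to a finite type. -/
noncomputable def stepLp (P : Measure X) [IsFiniteMeasure P] (hq : Measurable q)
    (c : κ → ℝ) : Lp ℝ 2 P :=
  (memLp_comp_finite P hq c 2).toLp _

variable [IsFiniteMeasure P]

theorem coeFn_stepLp (hq : Measurable q) (c : κ → ℝ) : stepLp P hq c =ᵐ[P] fun x => c (q x) :=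
  MemLp.coeFn_toLp _

theorem stepLp_sub (hq : Measurable q) (c d : κ → ℝ) :
    stepLp P hq (c - d) = stepLp P hq c - stepLp P hq d := by
  unfold stepLp
  rw [← MemLp.toLp_sub]
  rfl

theorem inner_stepLp (hq : Measurable q) (c : κ → ℝ) (K : Lp ℝ 2 P) :
    inner ℝ K (stepLp P hq c) = ∑ k, c k * ∫ x in q ⁻¹' {k}, K x ∂P := by
  rw [← integral_mul_comp_finite hq c ((Lp.memLp K).integrable one_le_two), L2.inner_def]
  refine integral_congr_ae ?_
  filter_upwards [coeFn_stepLp (P := P) hq c] with x hx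
  rw [hx]
  simp [mul_comm]

/-- The averages of `K` over the fibres of `q`, with the value `0` on null fibres. -/
noncomputable def fibreAverage (P : Measure X) (q : X → κ) (K : X → ℝ) (k : κ) : ℝ :=
  (P.real (q ⁻¹' {k}))⁻¹ * ∫ x in q ⁻¹' {k}, K x ∂P

/-- Averaging preserves the integral over each fibre; on null fibres both integrals vanish. -/
theorem inner_sub_stepLp_fibreAverage (hq : Measurable q) (c : κ → ℝ) (K : Lp ℝ 2 P) :
    inner ℝ (K - stepLp P hq (fibreAverage P q K)) (stepLp P hq c) = 0 := by
  rw [inner_sub_left, inner_stepLp, inner_stepLp, sub_eq_zero]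
  refine Finset.sum_congr rfl fun k _ => ?_
  congr 1
  have hm : MeasurableSet (q ⁻¹' {k}) := hq (measurableSet_singleton k)
  have h : ∫ x in q ⁻¹' {k}, stepLp P hq (fibreAverage P q K) x ∂P
      = ∫ _ in q ⁻¹' {k}, fibreAverage P q K k ∂P := by
    refine setIntegral_congr_ae hm ?_
    filter_upwards [coeFn_stepLp (P := P) hq (fibreAverage P q K)] with x hx hxk
    rw [hx, show q x = k from hxk]
  rw [h, setIntegral_const, smul_eq_mul, fibreAverage]
  by_cases h0 : P.real (q ⁻¹' {k}) = 0
  · rw [h0, zero_mul, setIntegral_measure_zero]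
    exact (measureReal_eq_zero_iff).1 h0
  · rw [mul_inv_cancel_left₀ h0]

/-- Pythagoras: any approximating step function may be replaced by the averages on its partition. -/
theorem norm_sub_stepLp_fibreAverage_le (hq : Measurable q) (c : κ → ℝ) (K : Lp ℝ 2 P) :
    ‖K - stepLp P hq (fibreAverage P q K)‖ ≤ ‖K - stepLp P hq c‖ := by
  set a := fibreAverage P q K
  have h := norm_add_sq_real (K - stepLp P hq a) (stepLp P hq (a - c))
  rw [inner_sub_stepLp_fibreAverage, stepLp_sub, sub_add_sub_cancel] at h
  refine le_of_sq_le_sq ?_ (norm_nonneg _)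
  nlinarith [sq_nonneg ‖stepLp P hq a - stepLp P hq c‖]

end StepFunctions

/-! ### Density of step kernels in `L²(V²)`. -/

section Rectangles

variable {V : Type*} [MeasurableSpace V]

/-- The kernels that are, almost everywhere, a function of the cells of `x` and `y` in a finite
measurable partition of `V`. -/
def stepKernels (ω : Measure V) : Submodule ℝ (L2Kernel ω) where
  carrier := {K | ∃ (n : ℕ) (q : V → Fin n) (c : Fin n × Fin n → ℝ), Measurable q ∧
    K =ᵐ[ω.prod ω] fun p => c (q p.1, q p.2)}
  zero_mem' := by
    by_cases h : Nonempty V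
    · exact ⟨1, fun _ => 0, 0, measurable_const, Lp.coeFn_zero ℝ 2 _⟩
    · exact ⟨0, fun x => (h ⟨x⟩).elim, 0, fun _ _ => by
        have := not_nonempty_iff.1 h
        exact Subsingleton.measurableSet, Lp.coeFn_zero ℝ 2 _⟩
  add_mem' := by
    rintro K L ⟨m, q, c, hq, hK⟩ ⟨n, s, d, hs, hL⟩
    -- The common refinement of the two partitions.
    refine ⟨m * n, fun x => finProdFinEquiv (q x, s x),
      fun p => c ((finProdFinEquiv.symm p.1).1, (finProdFinEquiv.symm p.2).1)
        + d ((finProdFinEquiv.symm p.1).2, (finProdFinEquiv.symm p.2).2),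
      (measurable_of_finite _).comp (hq.prodMk hs), ?_⟩
    filter_upwards [hK, hL, Lp.coeFn_add K L] with p h1 h2 h3
    rw [h3, Pi.add_apply, h1, h2]
    simp
  smul_mem' := by
    rintro a K ⟨m, q, c, hq, hK⟩
    refine ⟨m, q, fun p => a * c p, hq, ?_⟩
    filter_upwards [hK, Lp.coeFn_smul a K] with p h1 h2
    rw [h2, Pi.smul_apply, h1, smul_eq_mul]

theorem indicatorConstLp_prod_mem_stepKernels (ω : Measure V) [IsFiniteMeasure ω] {s t : Set V}
    (hs : MeasurableSet s) (ht : MeasurableSet t) :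
    indicatorConstLp 2 (hs.prod ht) (measure_ne_top (ω.prod ω) _) (1 : ℝ) ∈ stepKernels ω := by
  classical
  refine ⟨4, fun x => finProdFinEquiv (m := 2) (n := 2) (if x ∈ s then 1 else 0,
      if x ∈ t then 1 else 0),
    fun p => if (finProdFinEquiv (m := 2) (n := 2).symm p.1).1 = 1 ∧
      (finProdFinEquiv (m := 2) (n := 2).symm p.2).2 = 1 then 1 else 0,
    (measurable_of_finite _).comp ((Measurable.ite hs measurable_const measurable_const).prodMk
      (Measurable.ite ht measurable_const measurable_const)), ?_⟩
  filter_upwards [indicatorConstLp_coeFn (p := 2) (hs := hs.prod ht)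
    (hμs := measure_ne_top (ω.prod ω) _) (c := (1 : ℝ))] with p hp
  rw [hp]
  by_cases h1 : p.1 ∈ s <;> by_cases h2 : p.2 ∈ t <;> simp [Set.indicator, h1, h2]

/-- Rectangles form a π-system generating the product σ-algebra. -/
theorem ae_eq_zero_of_forall_setIntegral_prod_eq_zero (ω : Measure V) [IsFiniteMeasure ω]
    {K : V × V → ℝ} (hK : Integrable K (ω.prod ω))
    (h : ∀ s t : Set V, MeasurableSet s → MeasurableSet t →
      ∫ p in s ×ˢ t, K p ∂(ω.prod ω) = 0) : K =ᵐ[ω.prod ω] 0 := by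
  have huniv : ∫ p, K p ∂(ω.prod ω) = 0 := by
    have := h Set.univ Set.univ .univ .univ
    rwa [Set.univ_prod_univ, setIntegral_univ] at this
  refine hK.ae_eq_zero_of_forall_setIntegral_eq_zero fun s hs _ => ?_
  induction s, hs using MeasurableSpace.induction_on_inter generateFrom_prod.symm isPiSystem_prod with
  | empty => simp
  | basic u hu =>
    obtain ⟨s, hs, t, ht, rfl⟩ := hu
    exact h s t hs ht
  | compl u hu ih =>
    have := integral_add_compl hu hK
    have h2 := ih (measure_lt_top _ _)
    rw [huniv, h2, zero_add] at this
    exact this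
  | iUnion f hd hm ih =>
    rw [integral_iUnion hm hd hK.integrableOn]
    simp [ih _ (measure_lt_top _ _)]

theorem topologicalClosure_stepKernels (ω : Measure V) [IsFiniteMeasure ω] :
    (stepKernels ω).topologicalClosure = ⊤ := by
  rw [Submodule.topologicalClosure_eq_top_iff, Submodule.eq_bot_iff]
  intro K hK
  rw [Lp.eq_zero_iff_ae_eq_zero]
  refine ae_eq_zero_of_forall_setIntegral_prod_eq_zero ω ((Lp.memLp K).integrable one_le_two)
    fun s t hs ht => ?_
  rw [← L2.inner_indicatorConstLp_one (𝕜 := ℝ) (hs.prod ht) (measure_ne_top _ _) K]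
  exact hK _ (indicatorConstLp_prod_mem_stepKernels ω hs ht)

theorem measurable_prodMap_finite {κ : Type*} [MeasurableSpace κ] {q : V → κ} (hq : Measurable q) :
    Measurable fun p : V × V => (q p.1, q p.2) :=
  (hq.comp measurable_fst).prodMk (hq.comp measurable_snd)

theorem exists_stepLp_norm_sub_lt (ω : Measure V) [IsFiniteMeasure ω] (K : L2Kernel ω) {ε : ℝ}
    (hε : 0 < ε) : ∃ (n : ℕ) (q : V → Fin n) (hq : Measurable q),
      ‖K - stepLp (ω.prod ω) (measurable_prodMap_finite hq)
        (fibreAverage (ω.prod ω) (fun p : V × V => (q p.1, q p.2)) K)‖ < ε := by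
  have hK : K ∈ closure (stepKernels ω : Set (L2Kernel ω)) := by
    rw [← Submodule.topologicalClosure_coe, topologicalClosure_stepKernels]
    trivial
  obtain ⟨S, ⟨n, q, c, hq, hS⟩, hd⟩ := Metric.mem_closure_iff.1 hK ε hε
  refine ⟨n, q, hq, (norm_sub_stepLp_fibreAverage_le _ c K).trans_lt ?_⟩
  rw [dist_eq_norm] at hd
  have hSc : stepLp (ω.prod ω) (measurable_prodMap_finite hq) c = S :=
    Lp.ext ((coeFn_stepLp _ _).trans hS.symm)
  rwa [hSc]

end Rectangles

/-! ### Symmetrization as a sum over off-diagonal pairs. -/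

section Symmetrization

theorem exists_perm_apply_eq {ι : Type*} [DecidableEq ι] {i j a b : ι} (hij : i ≠ j)
    (hab : a ≠ b) : ∃ σ : Equiv.Perm ι, σ i = a ∧ σ j = b := by
  refine ⟨Equiv.swap (Equiv.swap i a j) b * Equiv.swap i a, ?_, ?_⟩
  · rw [Equiv.Perm.mul_apply, Equiv.swap_apply_left]
    refine Equiv.swap_apply_of_ne_of_ne (fun h => hij ?_) hab
    have := congrArg (Equiv.swap i a) h
    rwa [Equiv.swap_apply_right, Equiv.swap_apply_self] at this
  · rw [Equiv.Perm.mul_apply, Equiv.swap_apply_left]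

/-- Double counting: by 2-transitivity the sum over permutations is the same for every off-diagonal
pair, and each permutation preserves the off-diagonal sum. -/
theorem sum_perm_nonneg_of_sum_offDiag_nonneg {ι : Type*} [Fintype ι] [DecidableEq ι] {i j : ι}
    (hij : i ≠ j) (F : ι × ι → ℝ) (h : 0 ≤ ∑ p ∈ Finset.univ.offDiag, F p) :
    0 ≤ ∑ π : Equiv.Perm ι, F (π i, π j) := by
  have key : ∀ p ∈ (Finset.univ : Finset ι).offDiag,
      ∑ π : Equiv.Perm ι, F (π p.1, π p.2) = ∑ π : Equiv.Perm ι, F (π i, π j) := by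
    rintro ⟨a, b⟩ hp
    obtain ⟨σ, rfl, rfl⟩ := exists_perm_apply_eq hij (Finset.mem_offDiag.1 hp).2.2
    exact Fintype.sum_equiv (Equiv.mulRight σ) _ _ fun π => rfl
  have hinv : ∀ π : Equiv.Perm ι, ∑ p ∈ (Finset.univ : Finset ι).offDiag, F (π p.1, π p.2)
      = ∑ p ∈ (Finset.univ : Finset ι).offDiag, F p := by
    intro π
    refine Finset.sum_equiv (π.prodCongr π) (fun p => ?_) fun p _ => rfl
    simp
  have hcard : 0 < ((Finset.univ : Finset ι).offDiag.card : ℝ) :=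
    Nat.cast_pos.2 (Finset.card_pos.2 ⟨(i, j), by simpa using hij⟩)
  refine nonneg_of_mul_nonneg_right (a := ((Finset.univ : Finset ι).offDiag.card : ℝ)) ?_ hcard
  rw [← nsmul_eq_mul, ← Finset.sum_const, ← Finset.sum_congr rfl key, Finset.sum_comm]
  exact Finset.sum_nonneg fun π _ => (hinv π).symm ▸ h

end Symmetrization

/-! ### Membership in the cones `K_r`. -/

section KpCone

variable {V : Type*} [MeasurableSpace V]

theorem measurePreserving_eval_pair {ι : Type*} [Fintype ι] (ω : Measure V)
    [IsProbabilityMeasure ω] {i j : ι} (hij : i ≠ j) :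
    MeasurePreserving (fun x : ι → V => (x i, x j)) (Measure.pi fun _ => ω) (ω.prod ω) := by
  refine ⟨(measurable_pi_apply i).prodMk (measurable_pi_apply j), ?_⟩
  have h := (ProbabilityTheory.iIndepFun_pi (μ := fun _ : ι => ω) (X := fun _ => id)
    fun _ => aemeasurable_id).indepFun hij
  have h2 := h.map_prod_eq_prod_map_map (measurable_pi_apply i).aemeasurable
    (measurable_pi_apply j).aemeasurable
  have he : ∀ k : ι, Measure.map (fun x : ι → V => x k) (Measure.pi fun _ => ω) = ω :=
    fun k => (measurePreserving_eval (fun _ : ι => ω) k).map_eq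
  rw [he i, he j] at h2
  exact h2

theorem mem_symmKernels_of_ae_eq (ω : Measure V) [SFinite ω] {K : L2Kernel ω} {f : V × V → ℝ}
    (hK : K =ᵐ[ω.prod ω] f) (hf : ∀ x y, f (x, y) = f (y, x)) : K ∈ symmKernels ω := by
  change ∀ᵐ p ∂(ω.prod ω), K (p.1, p.2) = K (p.2, p.1)
  filter_upwards [hK, (Measure.measurePreserving_swap (μ := ω) (ν := ω)).quasiMeasurePreserving.ae hK]
    with p h1 h2
  exact h1.trans ((hf _ _).trans h2.symm)

theorem mem_kpCone_of_sum_offDiag_nonneg (ω : Measure V) [IsProbabilityMeasure ω] {r : ℕ}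
    {K : L2Kernel ω} {f : V × V → ℝ} (hK : K =ᵐ[ω.prod ω] f) (hf : ∀ x y, f (x, y) = f (y, x))
    (h : ∀ x : Fin (r + 2) → V, 0 ≤ ∑ p ∈ Finset.univ.offDiag, f (x p.1, x p.2)) :
    K ∈ kpCone ω r := by
  refine ⟨mem_symmKernels_of_ae_eq ω hK hf, ?_⟩
  have h01 : (0 : Fin (r + 2)) ≠ 1 := by simp
  have hae : ∀ᵐ x ∂(Measure.pi fun _ : Fin (r + 2) => ω), ∀ π : Equiv.Perm (Fin (r + 2)),
      K (x (π 0), x (π 1)) = f (x (π 0), x (π 1)) :=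
    ae_all_iff.2 fun π => (measurePreserving_eval_pair ω
      (π.injective.ne h01)).quasiMeasurePreserving.ae hK
  filter_upwards [hae] with x hx
  simp only [symmReynolds, tensorOnes, Finset.prod_const_one, mul_one, hx]
  exact mul_nonneg (by positivity)
    (sum_perm_nonneg_of_sum_offDiag_nonneg h01 (fun p => f (x p.1, x p.2)) (h x))

/-- If all finite sections of a bounded kernel have nonnegative total sum, then the kernel plus a
positive constant lies in the cones `K_r` for large `r`. -/
theorem add_const_mem_kpCone (ω : Measure V) [IsProbabilityMeasure ω] {K : L2Kernel ω}
    {f : V × V → ℝ} {M ε : ℝ} {r : ℕ} (hr : M ≤ ε * (r + 1))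
    (hK : K =ᵐ[ω.prod ω] fun p => f p + ε) (hf : ∀ x y, f (x, y) = f (y, x))
    (hM : ∀ x, f (x, x) ≤ M)
    (h : ∀ (n : ℕ) (x : Fin n → V), 0 ≤ ∑ a, ∑ b, f (x a, x b)) : K ∈ kpCone ω r := by
  refine mem_kpCone_of_sum_offDiag_nonneg ω hK (fun x y => by rw [hf]) fun x => ?_
  have hsplit : ∑ p ∈ Finset.univ.offDiag, f (x p.1, x p.2)
      = (∑ a, ∑ b, f (x a, x b)) - ∑ a, f (x a, x a) := by
    rw [← Finset.sum_product', ← Finset.diag_union_offDiag,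
      Finset.sum_union (Finset.disjoint_diag_offDiag _), Finset.sum_diag]
    ring
  have hdiag : ∑ a, f (x a, x a) ≤ (r + 2) * M := by
    refine (Finset.sum_le_sum fun a _ => hM (x a)).trans_eq ?_
    simp
  have hcard : (((Finset.univ : Finset (Fin (r + 2))).offDiag.card : ℕ) : ℝ)
      = (r + 2) * (r + 1) := by
    rw [Finset.offDiag_card, Finset.card_univ, Fintype.card_fin, ← Nat.mul_sub_one]
    push_cast
    simp
  rw [Finset.sum_add_distrib, hsplit, Finset.sum_const, nsmul_eq_mul, hcard]
  have h1 := h _ x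
  -- The gain `(r + 2) * (r + 1) * ε` covers the diagonal loss of at most `(r + 2) * M`.
  have h2 := mul_le_mul_of_nonneg_left hr (show (0 : ℝ) ≤ r + 2 by positivity)
  linarith [h1, h2, hdiag, mul_comm ε ((r : ℝ) + 1)]

theorem fibreAverage_swap {κ : Type*} [MeasurableSpace κ] [MeasurableSingletonClass κ]
    {ω : Measure V} [IsFiniteMeasure ω] {q : V → κ} (hq : Measurable q)
    {Z : L2Kernel ω} (hZ : Z ∈ symmKernels ω) (k l : κ) :
    fibreAverage (ω.prod ω) (fun p : V × V => (q p.1, q p.2)) Z (k, l)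
      = fibreAverage (ω.prod ω) (fun p : V × V => (q p.1, q p.2)) Z (l, k) := by
  have hpre : ∀ k l : κ, (fun p : V × V => (q p.1, q p.2)) ⁻¹' {(k, l)}
      = (q ⁻¹' {k}) ×ˢ (q ⁻¹' {l}) := fun k l => by
    ext p
    simp
  have hm : ∀ k, MeasurableSet (q ⁻¹' {k}) := fun k => hq (measurableSet_singleton k)
  simp only [fibreAverage, hpre, measureReal_prod_prod, mul_comm (ω.real (q ⁻¹' {k}))]
  congr 1
  have hswap : ∀ᵐ p ∂(ω.prod ω), Z (p.1, p.2) = Z (p.2, p.1) := hZ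
  have h : ∫ p in (q ⁻¹' {k}) ×ˢ (q ⁻¹' {l}), Z p ∂(ω.prod ω)
      = ∫ p in (q ⁻¹' {k}) ×ˢ (q ⁻¹' {l}), Z p.swap ∂(ω.prod ω) :=
    setIntegral_congr_ae ((hm k).prod (hm l)) (hswap.mono fun p hp _ => hp)
  rw [h, ← Set.preimage_swap_prod]
  exact (Measure.measurePreserving_swap (μ := ω) (ν := ω)).setIntegral_preimage_emb
    MeasurableEquiv.prodComm.measurableEmbedding _ _

end KpCone

/-! ### Averages of copositive kernels and the duality argument. -/

section Copositive

variable {V : Type*} [MeasurableSpace V] {κ : Type*} [Fintype κ] [MeasurableSpace κ]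
  [MeasurableSingletonClass κ] {ω : Measure V} [IsProbabilityMeasure ω] {q : V → κ}

theorem integral_kernelOp_stepLp (hq : Measurable q) (g : κ → ℝ) (Z : L2Kernel ω) :
    ∫ x, kernelOp ω Z (stepLp ω hq g) x * stepLp ω hq g x ∂ω
      = ∑ k : κ × κ, g k.1 * g k.2 *
        ∫ p in (fun p : V × V => (q p.1, q p.2)) ⁻¹' {k}, Z p ∂(ω.prod ω) := by
  have hZ : Integrable Z (ω.prod ω) := (Lp.memLp Z).integrable one_le_two
  have hint : Integrable (fun p : V × V => Z p * (g (q p.1) * g (q p.2))) (ω.prod ω) :=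
    ((memLp_comp_finite (ω.prod ω) (measurable_prodMap_finite hq)
      (fun k : κ × κ => g k.1 * g k.2) 2).integrable_mul (Lp.memLp Z)).congr
      (ae_of_all _ fun p => mul_comm _ _)
  rw [← integral_mul_comp_finite (measurable_prodMap_finite hq) (fun k : κ × κ => g k.1 * g k.2) hZ,
    integral_prod _ hint]
  refine integral_congr_ae ?_
  have hg := coeFn_stepLp (P := ω) hq g
  filter_upwards [hg] with x hx
  rw [hx, kernelOp, ← integral_mul_const]
  refine integral_congr_ae ?_
  filter_upwards [hg] with y hy
  rw [hy]
  ring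

theorem sum_sum_fibreAverage_nonneg (hq : Measurable q) {Z : L2Kernel ω} (hZ : Z ∈ copCone ω)
    {n : ℕ} (x : Fin n → V) :
    0 ≤ ∑ a, ∑ b, fibreAverage (ω.prod ω) (fun p : V × V => (q p.1, q p.2)) Z
      (q (x a), q (x b)) := by
  classical
  -- On a null cell the inverse is `0`, matching `fibreAverage`; hence the inequality holds at every
  -- choice of points, not just almost every one.
  let w : κ → ℝ := fun k => (ω.real (q ⁻¹' {k}))⁻¹
  let I : κ × κ → ℝ := fun k =>
    ∫ p in (fun p : V × V => (q p.1, q p.2)) ⁻¹' {k}, Z p ∂(ω.prod ω)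
  let g : κ → ℝ := fun k => ∑ a, if q (x a) = k then w k else 0
  have hg : ∀ k, 0 ≤ g k := fun k => Finset.sum_nonneg fun a _ => by
    split_ifs
    · exact inv_nonneg.2 measureReal_nonneg
    · exact le_rfl
  have havg : ∀ k : κ × κ, fibreAverage (ω.prod ω) (fun p : V × V => (q p.1, q p.2)) Z k
      = w k.1 * w k.2 * I k := by
    rintro ⟨k, l⟩
    have hpre : (fun p : V × V => (q p.1, q p.2)) ⁻¹' {(k, l)} = (q ⁻¹' {k}) ×ˢ (q ⁻¹' {l}) := by
      ext p
      simp
    simp only [fibreAverage, w, I]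
    rw [hpre, measureReal_prod_prod, mul_inv]
  have h := hZ.2 (stepLp ω hq g) (by
    filter_upwards [coeFn_stepLp (P := ω) hq g] with y hy
    rw [hy]
    exact hg _)
  rw [integral_kernelOp_stepLp] at h
  refine h.trans_eq ?_
  simp_rw [havg]
  change ∑ k : κ × κ, g k.1 * g k.2 * I k = _
  simp only [g, Finset.sum_mul, Finset.mul_sum]
  rw [Finset.sum_comm]
  conv_rhs => rw [Finset.sum_comm]
  refine Finset.sum_congr rfl fun b _ => ?_
  rw [Finset.sum_comm]
  refine Finset.sum_congr rfl fun a _ => ?_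
  rw [Finset.sum_eq_single (q (x a), q (x b))]
  · simp
  · rintro ⟨k, l⟩ - hkl
    by_cases h1 : q (x a) = k
    · have h2 : q (x b) ≠ l := fun h2 => hkl (by rw [h1, h2])
      simp [h2]
    · simp [h1]
  · simp

theorem inner_stepLp_fibreAverage_nonneg (hq : Measurable q) {A Z : L2Kernel ω}
    (hpos : ∀ K ∈ ⋃ (r : ℕ) (_ : 1 ≤ r), kpCone ω r, 0 ≤ inner ℝ A K) (hZ : Z ∈ copCone ω) :
    0 ≤ inner ℝ A (stepLp (ω.prod ω) (measurable_prodMap_finite hq)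
      (fibreAverage (ω.prod ω) (fun p : V × V => (q p.1, q p.2)) Z)) := by
  set c := fibreAverage (ω.prod ω) (fun p : V × V => (q p.1, q p.2)) Z with hc
  set J : L2Kernel ω := stepLp (ω.prod ω) (measurable_prodMap_finite hq) fun _ => 1
  have hε : ∀ ε : ℝ, 0 < ε →
      0 ≤ inner ℝ A (stepLp (ω.prod ω) (measurable_prodMap_finite hq) c) + ε * inner ℝ A J := by
    intro ε hε
    obtain ⟨M, hM⟩ := (Set.finite_range c).bddAbove
    obtain ⟨r, hr⟩ := exists_nat_ge (M / ε)
    have hr' : M ≤ ε * ((r + 1 : ℕ) + 1) := by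
      rw [div_le_iff₀' hε] at hr
      push_cast
      nlinarith
    rw [← real_inner_smul_right, ← inner_add_right]
    -- The shift to `r + 1` secures an index at least `1`.
    refine hpos _ (Set.mem_iUnion₂.2 ⟨r + 1, Nat.le_add_left 1 r, ?_⟩)
    refine add_const_mem_kpCone ω (f := fun p => c (q p.1, q p.2)) hr' ?_
      (fun x y => fibreAverage_swap hq hZ.1 _ _) (fun x => hM ⟨_, rfl⟩)
      fun n x => sum_sum_fibreAverage_nonneg hq hZ x
    filter_upwards [Lp.coeFn_add (stepLp (ω.prod ω) (measurable_prodMap_finite hq) c) (ε • J),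
      Lp.coeFn_smul ε J, coeFn_stepLp (P := ω.prod ω) (measurable_prodMap_finite hq) c,
      coeFn_stepLp (P := ω.prod ω) (measurable_prodMap_finite hq) fun _ => 1] with p h1 h2 h3 h4
    rw [h1, Pi.add_apply, h2, Pi.smul_apply, h3, h4, smul_eq_mul, mul_one]
  have hlim : Filter.Tendsto (fun ε : ℝ =>
      inner ℝ A (stepLp (ω.prod ω) (measurable_prodMap_finite hq) c) + ε * inner ℝ A J)
      (nhdsWithin 0 (Set.Ioi 0))
      (nhds (inner ℝ A (stepLp (ω.prod ω) (measurable_prodMap_finite hq) c) + 0 * inner ℝ A J)) :=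
    (Continuous.tendsto (by fun_prop) 0).mono_left nhdsWithin_le_nhds
  rw [zero_mul, add_zero] at hlim
  exact ge_of_tendsto hlim (Filter.eventually_of_mem self_mem_nhdsWithin hε)

/-- On any probability space, a symmetric kernel that is nonnegative on all the cones `K_r` with
`r ≥ 1` is completely positive. -/
theorem mem_cpCone_of_forall_kpCone {A : L2Kernel ω} (hA : A ∈ symmKernels ω)
    (hpos : ∀ Z ∈ ⋃ (r : ℕ) (_ : 1 ≤ r), kpCone ω r, 0 ≤ inner ℝ A Z) : A ∈ cpCone ω := by
  refine ⟨hA, fun Z hZ => ?_⟩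
  have hcl : IsClosed {K : L2Kernel ω | 0 ≤ inner ℝ A K} :=
    isClosed_le continuous_const (by fun_prop)
  refine hcl.closure_subset (Metric.mem_closure_iff.2 fun ε hε => ?_)
  obtain ⟨n, q, hq, h⟩ := exists_stepLp_norm_sub_lt ω Z hε
  exact ⟨_, inner_stepLp_fibreAverage_nonneg hq hpos hZ, by rwa [dist_eq_norm]⟩

end Copositive

theorem mainTheorem3 {Γ V : Type*}
    [Group Γ] [TopologicalSpace Γ] [IsTopologicalGroup Γ] [T2Space Γ] [CompactSpace Γ]
    [MeasurableSpace Γ] [BorelSpace Γ]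
    [TopologicalSpace V] [T2Space V] [MeasurableSpace V] [BorelSpace V]
    [MulAction Γ V] (hV : IsHomogeneousSpace Γ V)
    (μ : Measure Γ) [μ.IsHaarMeasure] [μ.Regular] [IsProbabilityMeasure μ] (e : V)
    (A : L2Kernel (haarPushforward μ e)) (hA : A ∈ symmKernels (haarPushforward μ e))
    (hpos : ∀ Z ∈ ⋃ (r : ℕ) (_ : 1 ≤ r), kpCone (haarPushforward μ e) r, 0 ≤ inner ℝ A Z) :
    A ∈ cpCone (haarPushforward μ e) := by
  have horbit : Continuous fun σ : Γ => σ • e :=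
    hV.continuous_action.comp (continuous_id.prodMk continuous_const)
  have : IsProbabilityMeasure (haarPushforward μ e) :=
    Measure.isProbabilityMeasure_map horbit.measurable.aemeasurable
  exact mem_cpCone_of_forall_kpCone hA hpos
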